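/- Let $\mathrm{CAR}(\mathbb{Z})$ be the universal unital $C^*$-algebra generated by elements $a_j$, $j\in\mathbb{Z}$, with adjoints $a_j^\dagger$, subject to $a_j^\dagger a_k+a_ka_j^\dagger=\delta_{j,k}I$ and $a_ja_k+a_ka_j=0$ for all $j,k\in\mathbb{Z}$. A state on $\mathrm{CAR}(\mathbb{Z})$ is called stationary if it is invariant under the automorphism determined by $a_j\mapsto a_{j+1}$, $j\in\mathbb{Z}$. For a bounded operator $Q$ on $\ell^2(\mathbb{Z})$ write $Q_{m,n}=\langle Qe_m,e_n\rangle$, where $(e_n)_{n\in\mathbb{Z}}$ is the canonical basis and the inner product is linear in its first variable; $Q$ is a Toeplitz operator if $Q_{m,n}$ depends only on $m-n$, and it is (weakly) diagonally dominant if $\sum_{n\neq m}|Q_{m,n}|\le |Q_{m,m}|$ for every $m\in\mathbb{Z}$. Then there are a constant $C>0$, a diagonally dominant Toeplitz operator $Q$ on $\ell^2(\mathbb{Z})$ with $0\le Q\le I$, and a stationary state $\omega$ on $\mathrm{CAR}(\mathbb{Z})$ that is the gauge-invariant quasi-free state with symbol $Q$, that is, $$\omega(a^\dagger_{i_1}\cdots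 a^\dagger_{i_p}\,a_{j_q}\cdots a_{j_1})=\delta_{p,q}\,\det\big[Q_{i_k,j_l}\big]_{k,l=1}^{p}$$ for all $p,q\ge 0$ and $i_1,\dots,i_p,j_1,\dots,j_q\in\mathbb{Z}$, such that $$\omega(a_m^\dagger a_n)=\imath\,\frac{3C}{\pi^2(m-n)^2}\qquad\text{for all } m,n\in\mathbb{Z}\text{ with } m>n .$$ -/

import Mathlib

open scoped ENNReal

noncomputable section

/-- The canonical anticommutation relations for a family `b` in a unital `*`-ring; the creator
`b_j†` is `star (b j)`. The relation for two creators is the adjoint of `anticomm`. -/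
structure IsCAR {ι : Type} {B : Type*} [Ring B] [StarRing B] (b : ι → B) : Prop where
  star_anticomm_self : ∀ j, star (b j) * b j + b j * star (b j) = 1
  star_anticomm : ∀ j k, j ≠ k → star (b j) * b k + b k * star (b j) = 0
  anticomm : ∀ j k, b j * b k + b k * b j = 0

theorem IsCAR.comp {ι κ : Type} {B : Type*} [Ring B] [StarRing B] {b : ι → B} (hb : IsCAR b)
    (f : κ ↪ ι) : IsCAR (fun j => b (f j)) :=
  ⟨fun _ => hb.1 _, fun _ _ h => hb.2 _ _ (f.injective.ne h), fun _ _ => hb.3 _ _⟩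

theorem IsCAR.norm_le_one {ι : Type} {B : Type*} [CStarAlgebra B] {b : ι → B} (hb : IsCAR b)
    (j : ι) : ‖b j‖ ≤ 1 := by
  have h2 : b j * b j = 0 := by
    have h := hb.anticomm j j
    rw [← two_smul ℂ (b j * b j)] at h
    exact (smul_eq_zero.mp h).resolve_left two_ne_zero
  have h1 : b j * star (b j) = 1 - star (b j) * b j := by
    rw [← hb.star_anticomm_self j]; abel
  have h3 : star (star (b j) * b j) * (star (b j) * b j) = star (b j) * b j := by
    calc star (star (b j) * b j) * (star (b j) * b j)
        = star (b j) * (b j * star (b j)) * b j := by simp [mul_assoc]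
      _ = star (b j) * b j - star (b j) * star (b j) * (b j * b j) := by
          rw [h1]; noncomm_ring
      _ = star (b j) * b j := by rw [h2, mul_zero, sub_zero]
  have h4 : ‖star (b j) * b j‖ * ‖star (b j) * b j‖ = ‖star (b j) * b j‖ := by
    rw [← CStarRing.norm_star_mul_self, h3]
  rw [CStarRing.norm_star_mul_self] at h4
  by_contra h
  nlinarith [mul_self_nonneg (‖b j‖), mul_lt_mul'' (not_le.mp h) (not_le.mp h) zero_le_one
    zero_le_one]

/-- A (nonzero) concrete realisation of the canonical anticommutation relations over `ι` in some
unital `C*`-algebra. -/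
structure CARFamily (ι : Type) : Type 1 where
  alg : Type
  [cstar : CStarAlgebra alg]
  [nontriv : Nontrivial alg]
  ann : ι → alg
  isCAR : IsCAR ann

attribute [instance] CARFamily.cstar CARFamily.nontriv

/-- Reindexing of a realisation along an injective map. -/
def CARFamily.reindex {ι : Type} (f : ι ↪ ι) (F : CARFamily ι) : CARFamily ι where
  alg := F.alg
  ann := fun j => F.ann (f j)
  isCAR := F.isCAR.comp f

/-- The `ℓ^∞`-direct product of all realisations. -/
abbrev CARProd (ι : Type) : Type 1 := lp (fun F : CARFamily ι => F.alg) ∞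

instance CARProd.instCStarAlgebra (ι : Type) : CStarAlgebra (CARProd ι) where

/-- The family of the annihilators `b_j` in the product of all realisations `b`. -/
def CARProd.ann {ι : Type} (j : ι) : CARProd ι :=
  ⟨fun F => F.ann j, memℓp_infty ⟨1, by rintro _ ⟨F, rfl⟩; exact F.isCAR.norm_le_one j⟩⟩

/-- The CAR algebra over `ι`, i.e. the universal unital `C*`-algebra generated by a family subject
to the canonical anticommutation relations: the closed unital `*`-subalgebra generated by
the annihilators in the product of all realisations. So the norm of a `*`-polynomial in the
generators is the supremum of its norms over all realisations; see `CAR.existsUnique_lift` for the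
universal property. (Realisations are taken in `Type`; this is no restriction when `ι` is
countable, as the `C*`-algebra generated by a realisation is then separable.) -/
def CARSub (ι : Type) : StarSubalgebra ℂ (CARProd ι) :=
  (StarAlgebra.adjoin ℂ (Set.range (CARProd.ann (ι := ι)))).topologicalClosure

/-- The CAR algebra over `ι` as a type. -/
abbrev CAR (ι : Type) : Type 1 := CARSub ι

theorem CARSub.isClosed (ι : Type) : IsClosed (CARSub ι : Set (CARProd ι)) :=
  StarSubalgebra.isClosed_topologicalClosure _

instance CAR.instCStarAlgebra (ι : Type) : CStarAlgebra (CAR ι) :=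
  StarSubalgebra.cstarAlgebra (CARSub ι) (h_closed := CARSub.isClosed ι)

namespace CAR

variable {ι : Type}

/-- The annihilator `a_j`; the creator `a_j†` is `star (CAR.a j)`. -/
def a (j : ι) : CAR ι :=
  ⟨CARProd.ann j, StarSubalgebra.le_topologicalClosure _
    (StarAlgebra.subset_adjoin ℂ _ (Set.mem_range_self j))⟩

theorem isCAR_a : IsCAR (a : ι → CAR ι) where
  star_anticomm_self j := by
    apply Subtype.ext; apply lp.ext; funext F; exact F.isCAR.star_anticomm_self j
  star_anticomm j k h := by
    apply Subtype.ext; apply lp.ext; funext F; exact F.isCAR.star_anticomm j k h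
  anticomm j k := by
    apply Subtype.ext; apply lp.ext; funext F; exact F.isCAR.anticomm j k

/-- The coordinate projection of the product onto a realisation. -/
def evalProd (F : CARFamily ι) : CARProd ι →⋆ₐ[ℂ] F.alg where
  toFun x := x F
  map_one' := rfl
  map_mul' _ _ := rfl
  map_zero' := rfl
  map_add' _ _ := rfl
  commutes' _ := rfl
  map_star' _ := rfl

/-- Two unital `*`-homomorphisms that agree on the generators are equal. -/
theorem hom_ext {B : Type*} [CStarAlgebra B] {φ ψ : CAR ι →⋆ₐ[ℂ] B}
    (h : ∀ j, φ (a j) = ψ (a j)) : φ = ψ := by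
  have hc (χ : CAR ι →⋆ₐ[ℂ] B) : Continuous χ :=
    AddMonoidHomClass.continuous_of_bound χ 1 fun x => by
      simpa using NonUnitalStarAlgHom.norm_apply_le χ x
  refine StarAlgHom.ext_topologicalClosure (hc φ) (hc ψ) ?_
  refine StarAlgHom.ext_adjoin ?_
  rintro ⟨_, hx⟩ ⟨j, rfl⟩
  exact h j

/-- The universal property of the CAR algebra. -/
theorem existsUnique_lift {B : Type} [CStarAlgebra B] [Nontrivial B] {b : ι → B} (hb : IsCAR b) :
    ∃! φ : CAR ι →⋆ₐ[ℂ] B, ∀ j, φ (a j) = b j :=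
  ⟨(evalProd ⟨B, b, hb⟩).comp (CARSub ι).subtype, fun _ => rfl,
    fun _ hψ => hom_ext fun j => hψ j⟩

/-- Reindexing as an endomorphism of the product of all realisations: the coordinate of the image
at the realisation `b` is the coordinate at the realisation `b ∘ f`. -/
def reindexProd (f : ι ↪ ι) : CARProd ι →⋆ₐ[ℂ] CARProd ι where
  toFun x := ⟨fun F => x (F.reindex f), memℓp_infty ⟨‖x‖, by
    rintro _ ⟨F, rfl⟩; exact lp.norm_apply_le_norm ENNReal.top_ne_zero x (F.reindex f)⟩⟩
  map_one' := rfl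
  map_mul' _ _ := rfl
  map_zero' := rfl
  map_add' _ _ := rfl
  commutes' _ := rfl
  map_star' _ := rfl

theorem reindexProd_mem (f : ι ↪ ι) (x : CARProd ι) (hx : x ∈ CARSub ι) :
    reindexProd f x ∈ CARSub ι := by
  have hc : Continuous (reindexProd f) :=
    AddMonoidHomClass.continuous_of_bound (reindexProd f) 1 fun x => by
      simpa using NonUnitalStarAlgHom.norm_apply_le (reindexProd f) x
  have hle : StarAlgebra.adjoin ℂ (Set.range (CARProd.ann (ι := ι))) ≤
      (CARSub ι).comap (reindexProd f) := by
    refine StarAlgebra.adjoin_le ?_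
    rintro _ ⟨j, rfl⟩
    exact (a (f j)).2
  exact StarSubalgebra.topologicalClosure_minimal hle ((CARSub.isClosed ι).preimage hc) hx

/-- The unital `*`-endomorphism of the CAR algebra with `a_j ↦ a_{f j}`, for `f` injective. -/
def reindex (f : ι ↪ ι) : CAR ι →⋆ₐ[ℂ] CAR ι :=
  ((reindexProd f).comp (CARSub ι).subtype).codRestrict (CARSub ι)
    fun x => reindexProd_mem f x x.2

theorem reindex_a (f : ι ↪ ι) (j : ι) : reindex f (a j) = a (f j) := rfl

end CAR

section States

open scoped ComplexOrder

/-- A state of a unital `*`-algebra: a normalised positive linear functional. -/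
structure AlgState (A : Type*) [Ring A] [StarRing A] [Algebra ℂ A] extends A →ₗ[ℂ] ℂ where
  map_one' : toFun 1 = 1
  nonneg' : ∀ x, 0 ≤ toFun (star x * x)

instance (A : Type*) [Ring A] [StarRing A] [Algebra ℂ A] :
    CoeFun (AlgState A) (fun _ => A → ℂ) where
  coe ω := ω.toLinearMap

end States

/-- Stationarity: invariance under the automorphism `a_j ↦ a_{j+1}`. -/
def IsStationaryState (ω : AlgState (CAR ℤ)) : Prop :=
  ∀ x : CAR ℤ, ω (CAR.reindex (addRightEmbedding (1 : ℤ)) x) = ω x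

/-- The Hilbert space `ℓ²(ℤ)`. -/
abbrev EllTwo : Type := lp (fun _ : ℤ => ℂ) 2

/-- The entry `Q_{m,n} = ⟨Q e_m, e_n⟩`, with the inner product linear in its first variable
(Mathlib's is linear in the second one), in the canonical basis of `ℓ²(ℤ)`. -/
def entry (Q : EllTwo →L[ℂ] EllTwo) (m n : ℤ) : ℂ :=
  inner ℂ (lp.single 2 n (1 : ℂ) : EllTwo) (Q (lp.single 2 m (1 : ℂ) : EllTwo))

/-- `Q` is a Toeplitz operator: `Q_{m,n}` depends only on `m - n`. -/
def IsToeplitz (Q : EllTwo →L[ℂ] EllTwo) : Prop :=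
  ∀ m n k : ℤ, entry Q (m + k) (n + k) = entry Q m n

/-- (Weak) row diagonal dominance: `∑_{n ≠ m} |Q_{m,n}| ≤ |Q_{m,m}|` for every `m`. -/
def IsDiagDominant (Q : EllTwo →L[ℂ] EllTwo) : Prop :=
  ∀ m : ℤ, Summable (fun n : {n : ℤ // n ≠ m} => ‖entry Q m n‖) ∧
    ∑' n : {n : ℤ // n ≠ m}, ‖entry Q m n‖ ≤ ‖entry Q m m‖

/-- `ω` is the gauge-invariant quasi-free state with symbol `Q`:
`ω(a†_{i_1} ⋯ a†_{i_p} a_{j_q} ⋯ a_{j_1}) = δ_{p,q} det [Q_{i_k, j_l}]`. -/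
def IsQuasiFreeState (ω : AlgState (CAR ℤ)) (Q : EllTwo →L[ℂ] EllTwo) : Prop :=
  ∀ (p q : ℕ) (i : Fin p → ℤ) (j : Fin q → ℤ),
    ω ((List.ofFn fun k => star (CAR.a (i k))).prod *
        (List.ofFn fun l => CAR.a (j l)).reverse.prod) =
      if h : p = q then
        Matrix.det (Matrix.of fun k l : Fin p => entry Q (i k) (j (Fin.cast h l)))
      else 0

end

/-!
The symbol is `Q = 1/2 + ∑_k t_k S_k`, with `S_k` the bilateral shift by `k` and
`t_k = -i sign(k) 3/(2π² k²)`, so that `C = 1/2`. The coefficients are Hermitian and,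
by `ζ(2) = π²/6`, their absolute values sum to `1/2`. This gives at once diagonal dominance and `‖Q - 1/2‖ ≤ 1/2`,
that is `0 ≤ Q ≤ 1`.

For any `0 ≤ Q ≤ 1` the quasi-free state is constructed by the Araki–Wyss method
(`exists_isQuasiFreeState`). The Fock space over `ℤ ⊕ ℤ` is realised as `ℓ²` of the finite subsets,
with Jordan–Wigner signs, and carries two mutually anticommuting families `b`, `b'` of annihilators.
They can be smeared with square-summable sequences, because the anticommutation relations bound the
norm of a finite combination by the `ℓ²`-norm of its coefficients. With `Q = X†X` and `1 - Q = Y†Y`,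
the operators `a_j = b(conj (Y e_j)) + b'(X e_j)†` satisfy the canonical anticommutation relations,
and the vacuum vector state is quasi-free with symbol `Q`: on the vacuum `a_j` acts as
`D_j = b'(X e_j)†`, whose adjoint kills the vacuum, so moving `D_j` from the right end of a
normal-ordered monomial to the left end leaves the contractions with the creators `a_i†`, each
equal to `Q_{i,j}`. This is the Laplace expansion of the determinant (`wick`).

Normal-ordered monomials span a dense subspace of the CAR algebra (`CAR.functional_ext`), so a
continuous quasi-free state is determined by its symbol, and for a Toeplitz symbol it is stationary.
-/

noncomputable section

theorem HasSum.of_eq {ι M : Type*} [AddCommMonoid M] [TopologicalSpace M] {f g : ι → M} {m : M}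
    (h : HasSum g m) (hfg : ∀ k, f k = g k) : HasSum f m :=
  (funext hfg : f = g) ▸ h

/-! ### Weighted composition operators on `ℓ²(X)` -/

section WeightedComposition

variable {X : Type}

theorem summable_comp_perm (σ : Equiv.Perm X) (ψ : lp (fun _ : X => ℂ) 2) :
    Summable fun x => ‖ψ (σ x)‖ ^ (2 : ℝ≥0∞).toReal :=
  ((memℓp_gen_iff (by simp)).mp (lp.memℓp ψ)).comp_injective σ.injective

theorem norm_weight_mul_le {c : X → ℂ} (hc : ∀ x, ‖c x‖ ≤ 1) (ψ : X → ℂ) (σ : Equiv.Perm X)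
    (x : X) : ‖c x * ψ (σ x)‖ ^ (2 : ℝ≥0∞).toReal ≤ ‖ψ (σ x)‖ ^ (2 : ℝ≥0∞).toReal := by
  refine Real.rpow_le_rpow (norm_nonneg _) ?_ (by simp)
  rw [norm_mul]
  exact mul_le_of_le_one_left (norm_nonneg _) (hc x)

theorem summable_weight_mul {c : X → ℂ} (hc : ∀ x, ‖c x‖ ≤ 1) (σ : Equiv.Perm X)
    (ψ : lp (fun _ : X => ℂ) 2) :
    Summable fun x => ‖c x * ψ (σ x)‖ ^ (2 : ℝ≥0∞).toReal :=
  (summable_comp_perm σ ψ).of_nonneg_of_le (fun _ => by positivity) (norm_weight_mul_le hc ψ σ)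

/-- The operator `(W ψ)(x) = c(x) ψ(σ x)` on `ℓ²(X)`, for a permutation `σ` of `X` and a weight `c`
bounded by `1`, as a linear map. -/
def weightedCompLinear (c : X → ℂ) (σ : Equiv.Perm X) (hc : ∀ x, ‖c x‖ ≤ 1) :
    lp (fun _ : X => ℂ) 2 →ₗ[ℂ] lp (fun _ : X => ℂ) 2 where
  toFun ψ := ⟨fun x => c x * ψ (σ x), (memℓp_gen_iff (by simp)).mpr (summable_weight_mul hc σ ψ)⟩
  map_add' ψ φ := by ext x; exact mul_add _ _ _
  map_smul' r ψ := by ext x; exact mul_left_comm _ _ _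

theorem norm_weightedCompLinear_le (c : X → ℂ) (σ : Equiv.Perm X) (hc : ∀ x, ‖c x‖ ≤ 1)
    (ψ : lp (fun _ : X => ℂ) 2) : ‖weightedCompLinear c σ hc ψ‖ ≤ 1 * ‖ψ‖ := by
  rw [one_mul]
  refine (Real.rpow_le_rpow_iff (norm_nonneg _) (norm_nonneg _)
    (show 0 < (2 : ℝ≥0∞).toReal by simp)).mp ?_
  rw [lp.norm_rpow_eq_tsum (by simp), lp.norm_rpow_eq_tsum (by simp),
    ← σ.tsum_eq fun x => ‖ψ x‖ ^ (2 : ℝ≥0∞).toReal]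
  exact (summable_weight_mul hc σ ψ).tsum_le_tsum (norm_weight_mul_le hc ψ σ)
    (summable_comp_perm σ ψ)

/-- The operator `(W ψ)(x) = c(x) ψ(σ x)` on `ℓ²(X)` as a bounded operator. Both the fermionic
annihilators and the bilateral shifts have this form. -/
def weightedComp (c : X → ℂ) (σ : Equiv.Perm X) (hc : ∀ x, ‖c x‖ ≤ 1) :
    lp (fun _ : X => ℂ) 2 →L[ℂ] lp (fun _ : X => ℂ) 2 :=
  (weightedCompLinear c σ hc).mkContinuous 1 (norm_weightedCompLinear_le c σ hc)

variable (c : X → ℂ) (σ : Equiv.Perm X) (hc : ∀ x, ‖c x‖ ≤ 1)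

@[simp]
theorem weightedComp_apply (ψ : lp (fun _ : X => ℂ) 2) (x : X) :
    weightedComp c σ hc ψ x = c x * ψ (σ x) := rfl

theorem norm_weightedComp_le : ‖weightedComp c σ hc‖ ≤ 1 :=
  LinearMap.mkContinuous_norm_le _ zero_le_one _

theorem star_weightedComp :
    star (weightedComp c σ hc) =
      weightedComp (fun x => star (c (σ.symm x))) σ.symm (fun x => by simpa using hc _) := by
  symm
  rw [ContinuousLinearMap.star_eq_adjoint, ContinuousLinearMap.eq_adjoint_iff]
  intro ψ φ
  refine (lp.hasSum_inner _ _).unique ?_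
  rw [← σ.hasSum_iff]
  refine (lp.hasSum_inner ψ (weightedComp c σ hc φ)).of_eq fun x => ?_
  simp only [Function.comp_apply, weightedComp_apply, Equiv.symm_apply_apply, RCLike.inner_apply,
    map_mul, Complex.star_def, Complex.conj_conj]
  ring

end WeightedComposition

/-! ### The Fock representation -/

section Fock

variable {I : Type} [LinearOrder I]

/-- The involution of the finite subsets of `I` that toggles membership of `j`. -/
def toggle (j : I) : Equiv.Perm (Finset I) := (symmDiff_left_involutive {j}).toPerm

theorem toggle_apply (j : I) (S : Finset I) : toggle j S = symmDiff S {j} := rfl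

@[simp]
theorem toggle_symm (j : I) : (toggle j).symm = toggle j := rfl

@[simp]
theorem toggle_toggle (j : I) (S : Finset I) : toggle j (toggle j S) = S :=
  symmDiff_symmDiff_cancel_right _ _

theorem toggle_comm (j k : I) (S : Finset I) : toggle j (toggle k S) = toggle k (toggle j S) :=
  symmDiff_right_comm _ _ _

@[simp]
theorem mem_toggle_self (j : I) (S : Finset I) : j ∈ toggle j S ↔ j ∉ S := by
  simp [toggle_apply, Finset.mem_symmDiff]

theorem mem_toggle_of_ne {j k : I} (h : j ≠ k) (S : Finset I) : j ∈ toggle k S ↔ j ∈ S := by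
  simp [toggle_apply, Finset.mem_symmDiff, h]

/-- The Jordan–Wigner sign `(-1) ^ #{i ∈ S | i < j}`. -/
def jwSign (j : I) (S : Finset I) : ℂ := (-1) ^ (S.filter (· < j)).card

theorem jwSign_mul_self (j : I) (S : Finset I) : jwSign j S * jwSign j S = 1 := by
  rw [jwSign, ← mul_pow]; simp

theorem star_jwSign (j : I) (S : Finset I) : star (jwSign j S) = jwSign j S := by
  simp [jwSign]

theorem jwSign_toggle_of_not_lt {j k : I} (h : ¬ k < j) (S : Finset I) :
    jwSign j (toggle k S) = jwSign j S := by
  unfold jwSign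
  congr 2
  ext i
  rw [Finset.mem_filter, Finset.mem_filter]
  refine and_congr_left fun hi => mem_toggle_of_ne ?_ S
  rintro rfl
  exact h hi

theorem jwSign_toggle_of_lt {j k : I} (h : k < j) (S : Finset I) :
    jwSign j (toggle k S) = - jwSign j S := by
  have key (T : Finset I) (hk : k ∉ T) : jwSign j (toggle k T) = - jwSign j T := by
    have : (toggle k T).filter (· < j) = insert k (T.filter (· < j)) := by
      ext i
      by_cases hi : i = k
      · subst hi; simp [hk, h]
      · simp [mem_toggle_of_ne hi, hi]
    unfold jwSign
    rw [this, Finset.card_insert_of_notMem (by simp [hk]), pow_succ, mul_neg_one]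
  by_cases hk : k ∈ S
  · have := key (toggle k S) (by simpa using hk)
    rw [toggle_toggle] at this
    rw [this, neg_neg]
  · exact key S hk

/-- The weight of the annihilator `b_j` on the Fock space `ℓ²(Finset I)`. -/
def fockWeight (j : I) (S : Finset I) : ℂ := if j ∈ S then 0 else jwSign j S

theorem norm_fockWeight_le (j : I) (S : Finset I) : ‖fockWeight j S‖ ≤ 1 := by
  unfold fockWeight jwSign
  split_ifs <;> simp

/-- The annihilator `b_j` of the fermionic Fock space over `ℓ²(I)`, realised as `ℓ²(Finset I)`: the
basis vector of `S` goes to `±` that of `S \ {j}` if `j ∈ S`, with the Jordan–Wigner sign, and to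
`0` otherwise. -/
def fockAnn (j : I) : lp (fun _ : Finset I => ℂ) 2 →L[ℂ] lp (fun _ : Finset I => ℂ) 2 :=
  weightedComp (fockWeight j) (toggle j) (norm_fockWeight_le j)

theorem fockAnn_apply (j : I) (ψ : lp (fun _ : Finset I => ℂ) 2) (S : Finset I) :
    fockAnn j ψ S = (if j ∈ S then 0 else jwSign j S) * ψ (toggle j S) := rfl

theorem star_fockAnn_apply (j : I) (ψ : lp (fun _ : Finset I => ℂ) 2) (S : Finset I) :
    star (fockAnn j) ψ S = (if j ∈ S then jwSign j S else 0) * ψ (toggle j S) := by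
  rw [fockAnn, star_weightedComp, weightedComp_apply]
  simp only [toggle_symm, fockWeight, mem_toggle_self, ite_not,
    jwSign_toggle_of_not_lt (lt_irrefl j)]
  split_ifs
  · rw [star_jwSign]
  · rw [star_zero]

theorem isCAR_fockAnn : IsCAR (fockAnn : I → _) where
  star_anticomm_self j := by
    ext ψ S
    have h := jwSign_mul_self j S
    by_cases hj : j ∈ S <;>
    simp [fockAnn_apply, star_fockAnn_apply, hj, jwSign_toggle_of_not_lt (lt_irrefl j),
      ← mul_assoc, h]
  star_anticomm j k hjk := by
    ext ψ S
    rcases lt_or_gt_of_ne hjk with h | h <;> by_cases hj : j ∈ S <;> by_cases hk : k ∈ S <;>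
    simp [fockAnn_apply, star_fockAnn_apply, mem_toggle_of_ne hjk, mem_toggle_of_ne hjk.symm,
      hj, hk, jwSign_toggle_of_lt h, jwSign_toggle_of_not_lt h.not_gt, toggle_comm j k] <;> ring
  anticomm j k := by
    ext ψ S
    rcases lt_trichotomy j k with h | rfl | h
    · by_cases hj : j ∈ S <;> by_cases hk : k ∈ S <;>
      simp [fockAnn_apply, mem_toggle_of_ne h.ne, mem_toggle_of_ne h.ne',
        hj, hk, jwSign_toggle_of_lt h, jwSign_toggle_of_not_lt h.not_gt, toggle_comm j k] ; ring
    · by_cases hj : j ∈ S <;> simp [fockAnn_apply, hj]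
    · by_cases hj : j ∈ S <;> by_cases hk : k ∈ S <;>
      simp [fockAnn_apply, mem_toggle_of_ne h.ne, mem_toggle_of_ne h.ne',
        hj, hk, jwSign_toggle_of_lt h, jwSign_toggle_of_not_lt h.not_gt, toggle_comm j k] ; ring

/-- The Fock vacuum, the basis vector of the empty set. -/
def fockVacuum (I : Type) [LinearOrder I] : lp (fun _ : Finset I => ℂ) 2 := lp.single 2 ∅ (1 : ℂ)

theorem inner_fockVacuum_self : (inner ℂ (fockVacuum I) (fockVacuum I) : ℂ) = 1 := by
  rw [fockVacuum, lp.inner_single_left]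
  simp

theorem fockAnn_fockVacuum (j : I) : fockAnn j (fockVacuum I) = 0 := by
  ext S
  rw [fockAnn_apply]
  by_cases hj : j ∈ S
  · simp [hj]
  · have : toggle j S ≠ ∅ := Finset.ne_empty_of_mem ((mem_toggle_self j S).mpr hj)
    simp [fockVacuum, lp.single_apply, this]

end Fock

/-! ### Smeared annihilators -/

section Smeared

variable {ι : Type} {B : Type*} [CStarAlgebra B]

/-- The `C*`-identity gives `‖x†x‖² = ‖(x†x)²‖ = r ‖x†x‖`, as `(x†x)² = r x†x`. -/
theorem norm_le_of_anticomm {x : B} {r : ℝ} (hr : 0 ≤ r) (hx : x * x = 0)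
    (h : star x * x + x * star x = (r : ℂ) • 1) : ‖x‖ ≤ √r := by
  have h1 : x * star x = (r : ℂ) • 1 - star x * x := by rw [← h]; abel
  have h3 : star (star x * x) * (star x * x) = (r : ℂ) • (star x * x) := by
    calc star (star x * x) * (star x * x) = star x * (x * star x) * x := by simp [mul_assoc]
      _ = (r : ℂ) • (star x * x) - star x * star x * (x * x) := by
          rw [h1, mul_sub, sub_mul]; simp [mul_assoc]
      _ = (r : ℂ) • (star x * x) := by rw [hx, mul_zero, sub_zero]
  have h4 : ‖star x * x‖ * ‖star x * x‖ = r * ‖star x * x‖ := by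
    rw [← CStarRing.norm_star_mul_self, h3, norm_smul, Complex.norm_real, Real.norm_of_nonneg hr]
  rw [CStarRing.norm_star_mul_self] at h4
  refine Real.le_sqrt_of_sq_le ?_
  by_contra hlt
  rw [not_le, sq] at hlt
  exact absurd h4 (mul_lt_mul_of_pos_right hlt (hr.trans_lt hlt)).ne'

theorem IsCAR.mul_self_sum {b : ι → B} (hb : IsCAR b) (f : ι → ℂ) (s : Finset ι) :
    (∑ k ∈ s, f k • b k) * (∑ k ∈ s, f k • b k) = 0 := by
  have h : (2 : ℂ) • ((∑ k ∈ s, f k • b k) * (∑ k ∈ s, f k • b k)) = 0 := by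
    rw [two_smul, Finset.sum_mul_sum]
    nth_rewrite 2 [Finset.sum_comm]
    rw [← Finset.sum_add_distrib]
    refine Finset.sum_eq_zero fun k _ => ?_
    rw [← Finset.sum_add_distrib]
    refine Finset.sum_eq_zero fun l _ => ?_
    rw [smul_mul_smul_comm, smul_mul_smul_comm, mul_comm (f l), ← smul_add, hb.anticomm, smul_zero]
  exact (smul_eq_zero.mp h).resolve_left two_ne_zero

theorem IsCAR.star_anticomm_eq [DecidableEq ι] {b : ι → B} (hb : IsCAR b) (j k : ι) :
    star (b j) * b k + b k * star (b j) = if j = k then 1 else 0 := by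
  split_ifs with h
  · rw [h, hb.star_anticomm_self]
  · exact hb.star_anticomm j k h

theorem IsCAR.star_anticomm_sum {b : ι → B} (hb : IsCAR b) (f : ι → ℂ) (s : Finset ι) :
    star (∑ k ∈ s, f k • b k) * (∑ k ∈ s, f k • b k) +
      (∑ k ∈ s, f k • b k) * star (∑ k ∈ s, f k • b k) =
        ((∑ k ∈ s, ‖f k‖ ^ 2 : ℝ) : ℂ) • (1 : B) := by
  classical
  rw [star_sum, Finset.sum_mul_sum, Finset.sum_mul_sum]
  nth_rewrite 2 [Finset.sum_comm]
  rw [← Finset.sum_add_distrib, Complex.ofReal_sum, Finset.sum_smul]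
  refine Finset.sum_congr rfl fun k hk => ?_
  rw [← Finset.sum_add_distrib, Finset.sum_eq_single_of_mem k hk]
  · rw [star_smul, smul_mul_smul_comm, smul_mul_smul_comm, mul_comm (f k), ← smul_add,
      hb.star_anticomm_self]
    congr 1
    rw [Complex.star_def, ← Complex.normSq_eq_conj_mul_self, Complex.normSq_eq_norm_sq]
  · intro l _ hl
    rw [star_smul, smul_mul_smul_comm, smul_mul_smul_comm, mul_comm (f l), ← smul_add,
      hb.star_anticomm k l hl.symm, smul_zero]

/-- Finite linear combinations of CAR generators have norm at most the `ℓ²`-norm of the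
coefficients, so that square-summable combinations converge in norm. -/
theorem IsCAR.summable_smul {b : ι → B} (hb : IsCAR b) (f : lp (fun _ : ι => ℂ) 2) :
    Summable fun k => f k • b k := by
  have hf : Summable fun k => ‖f k‖ ^ 2 := by
    simpa using (memℓp_gen_iff (p := 2) (by simp)).mp (lp.memℓp f)
  rw [summable_iff_vanishing_norm]
  intro ε hε
  obtain ⟨s, hs⟩ := summable_iff_vanishing_norm.mp hf (ε ^ 2) (by positivity)
  refine ⟨s, fun t ht => ?_⟩
  have h0 : 0 ≤ ∑ k ∈ t, ‖f k‖ ^ 2 := Finset.sum_nonneg fun _ _ => by positivity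
  refine (norm_le_of_anticomm h0 (hb.mul_self_sum f t) (hb.star_anticomm_sum f t)).trans_lt ?_
  rw [Real.sqrt_lt' hε]
  exact (Real.le_norm_self _).trans_lt (hs t ht)

/-- The smeared annihilator `b(f) = ∑ₖ f_k b_k`, linear in `f ∈ ℓ²(ι)`. -/
def smear (b : ι → B) (f : lp (fun _ : ι => ℂ) 2) : B := ∑' k, f k • b k

theorem IsCAR.hasSum_smear {b : ι → B} (hb : IsCAR b) (f : lp (fun _ : ι => ℂ) 2) :
    HasSum (fun k => f k • b k) (smear b f) :=
  (hb.summable_smul f).hasSum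

theorem IsCAR.smear_anticomm_of {b : ι → B} (hb : IsCAR b) (f : lp (fun _ : ι => ℂ) 2) {z : B}
    (h : ∀ k, b k * z + z * b k = 0) : smear b f * z + z * smear b f = 0 := by
  have h1 := ((hb.hasSum_smear f).mul_right z).add ((hb.hasSum_smear f).mul_left z)
  refine h1.unique (hasSum_zero.of_eq fun k => ?_)
  rw [smul_mul_assoc, mul_smul_comm, ← smul_add, h, smul_zero]

theorem IsCAR.smear_anticomm {b : ι → B} (hb : IsCAR b) (f g : lp (fun _ : ι => ℂ) 2) :
    smear b f * smear b g + smear b g * smear b f = 0 :=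
  hb.smear_anticomm_of f fun k => by
    rw [add_comm]
    exact hb.smear_anticomm_of g fun l => hb.anticomm l k

theorem IsCAR.star_smear_anticomm {b : ι → B} (hb : IsCAR b) (f g : lp (fun _ : ι => ℂ) 2) :
    star (smear b f) * smear b g + smear b g * star (smear b f) = (inner ℂ f g : ℂ) • 1 := by
  classical
  have h1 (l : ι) : star (b l) * smear b g + smear b g * star (b l) = g l • 1 := by
    have h := ((hb.hasSum_smear g).mul_left (star (b l))).add
      ((hb.hasSum_smear g).mul_right (star (b l)))
    refine h.unique ((hasSum_ite_eq l (g l • (1 : B))).of_eq fun k => ?_)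
    rw [smul_mul_assoc, mul_smul_comm, ← smul_add, hb.star_anticomm_eq]
    by_cases hk : k = l
    · simp [hk]
    · simp [hk, Ne.symm hk]
  have h2 := (((hb.hasSum_smear f).star).mul_right (smear b g)).add
      (((hb.hasSum_smear f).star).mul_left (smear b g))
  refine h2.unique (((lp.hasSum_inner (𝕜 := ℂ) f g).smul_const (1 : B)).of_eq fun k => ?_)
  rw [star_smul, smul_mul_assoc, mul_smul_comm, ← smul_add, h1, smul_smul, RCLike.inner_apply',
    Complex.star_def]

end Smeared

/-! ### The Wick formula -/

section Wick

theorem star_list_prod {B : Type*} [Ring B] [StarRing B] (L : List B) :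
    star L.prod = (L.map star).reverse.prod := by
  induction L with
  | nil => simp
  | cons x L ih => simp [ih]

variable {ι : Type} {B : Type*} [Ring B] [Algebra ℂ B]

theorem prod_mul_anticomm {D : B} (L : List B) (h : ∀ x ∈ L, D * x + x * D = 0) :
    L.prod * D = (-1 : ℂ) ^ L.length • (D * L.prod) := by
  induction L with
  | nil => simp
  | cons x L ih =>
    rw [List.prod_cons, mul_assoc, ih fun y hy => h y (List.mem_cons_of_mem _ hy), mul_smul_comm,
      ← mul_assoc, ← mul_assoc, eq_neg_of_add_eq_zero_right (h x List.mem_cons_self), neg_mul,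
      List.length_cons, pow_succ, mul_neg_one, neg_smul, smul_neg]

variable [StarRing B]

/-- Moving `D` to the right past a product of creators leaves one contraction per creator. -/
theorem mul_prod_star_eq {a : ι → B} {D : B} {q : ι → ℂ}
    (hD : ∀ i, D * star (a i) + star (a i) * D = q i • 1) :
    ∀ (p : ℕ) (i : Fin (p + 1) → ι),
      D * (List.ofFn fun k => star (a (i k))).prod =
        ∑ k : Fin (p + 1), ((-1) ^ (k : ℕ) * q (i k)) •
            (List.ofFn fun l => star (a (i (k.succAbove l)))).prod +
          (-1 : ℂ) ^ (p + 1) • ((List.ofFn fun k => star (a (i k))).prod * D) := by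
  have hD' (i : ι) : D * star (a i) = q i • 1 - star (a i) * D := by rw [← hD]; abel
  intro p
  induction p with
  | zero =>
    intro i
    simp [hD', sub_eq_add_neg]
  | succ p ih =>
    intro i
    rw [List.ofFn_succ, List.prod_cons, ← mul_assoc, hD', sub_mul, mul_assoc,
      ih fun k => i k.succ, Fin.sum_univ_succ (n := p + 1), mul_add, Finset.mul_sum]
    simp only [Fin.val_zero, pow_zero, one_mul, Fin.succAbove_zero, Fin.val_succ, mul_smul_comm,
      smul_mul_assoc]
    rw [sub_eq_add_neg, neg_add, add_assoc (q (i 0) • _)]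
    congr 1
    congr 1
    · rw [← Finset.sum_neg_distrib]
      refine Finset.sum_congr rfl fun k _ => ?_
      rw [List.ofFn_succ (f := fun l => star (a (i (k.succ.succAbove l)))), List.prod_cons,
        ← neg_smul]
      simp only [Fin.succ_succAbove_zero, Fin.succ_succAbove_succ]
      congr 1
      ring
    · rw [← neg_smul, mul_assoc, show (-1 : ℂ) ^ (p + 1 + 1) = -(-1) ^ (p + 1) by ring]

/-- A Wick theorem (`p` creators, `r` annihilators). Suppose that `a_j` may be replaced under `φ` by
`D_j` at the right end, that `φ` vanishes on products with `D_j` at the left end, and that `D_j`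
anticommutes with all `a_k` and has scalar anticommutator `q_{ij}` with `a_i†`. Moving
`D_j` from the right end to the left end of a normal-ordered monomial produces the Laplace expansion
of the determinant along its first column. -/
theorem wick {a D : ι → B} {q : ι → ι → ℂ} (φ : B →ₗ[ℂ] ℂ) (hφ1 : φ 1 = 1)
    (hstar : ∀ x, φ (star x) = star (φ x)) (hright : ∀ x j, φ (x * a j) = φ (x * D j))
    (hleft : ∀ x j, φ (D j * x) = 0) (hDa : ∀ j k, D j * a k + a k * D j = 0)
    (hDs : ∀ j i, D j * star (a i) + star (a i) * D j = q i j • 1) :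
    ∀ (r p : ℕ) (i : Fin p → ι) (j : Fin r → ι),
      φ ((List.ofFn fun k => star (a (i k))).prod * (List.ofFn fun l => a (j l)).reverse.prod) =
        if h : p = r then
          Matrix.det (Matrix.of fun k l : Fin p => q (i k) (j (Fin.cast h l)))
        else 0 := by
  have hmove (P : B) (r : ℕ) (j : Fin (r + 1) → ι) :
      φ (P * (List.ofFn fun l => a (j l)).reverse.prod) =
        (-1) ^ r * φ (P * D (j 0) * (List.ofFn fun l => a (j l.succ)).reverse.prod) := by
    rw [List.ofFn_succ, List.reverse_cons, List.prod_append, List.prod_singleton, ← mul_assoc,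
      hright, mul_assoc, prod_mul_anticomm, mul_smul_comm, map_smul, smul_eq_mul, ← mul_assoc]
    · simp
    · intro x hx
      rw [List.mem_reverse, List.mem_ofFn] at hx
      obtain ⟨l, rfl⟩ := hx
      exact hDa _ _
  -- Without creators nothing contracts with `D`; a product of creators is the adjoint of such.
  have hann (r : ℕ) (j : Fin (r + 1) → ι) : φ (List.ofFn fun l => a (j l)).reverse.prod = 0 := by
    rw [← one_mul (List.prod _), hmove, one_mul, hleft, mul_zero]
  intro r
  induction r with
  | zero =>
    intro p i j
    cases p with
    | zero => simp [hφ1]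
    | succ p =>
      rw [dif_neg (Nat.succ_ne_zero p), List.ofFn_zero, List.reverse_nil, List.prod_nil, mul_one,
        ← star_star (List.prod _), hstar, star_list_prod, List.map_ofFn]
      simp only [Function.comp_def, star_star]
      rw [hann, star_zero]
  | succ r ih =>
    intro p i j
    rw [hmove]
    cases p with
    | zero =>
      rw [List.ofFn_zero, List.prod_nil, one_mul, hleft, mul_zero,
        dif_neg (Nat.succ_ne_zero r).symm]
    | succ p =>
      have hP := mul_prod_star_eq (hDs (j 0)) p i
      have hP' := eq_sub_of_add_eq' hP.symm
      set P := (List.ofFn fun k => star (a (i k))).prod with hPdef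
      set R := (List.ofFn fun l => a (j l.succ)).reverse.prod with hR
      have hexp : φ (P * D (j 0) * R) = (-1) ^ p * ∑ k : Fin (p + 1), ((-1) ^ (k : ℕ) *
          q (i k) (j 0)) * φ ((List.ofFn fun l => star (a (i (k.succAbove l)))).prod * R) := by
        have h := congrArg (fun x => φ (x * R)) hP'
        simp only [sub_mul, smul_mul_assoc, map_smul, map_sub, Finset.sum_mul, map_sum, mul_assoc,
          hleft, smul_eq_mul] at h
        have hs : ((-1 : ℂ) ^ p) * (-1) ^ p = 1 := by rw [← mul_pow]; simp
        rw [mul_assoc]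
        simp only [mul_assoc]
        linear_combination (-(-1 : ℂ) ^ p) * h - (φ (P * (D (j 0) * R))) * hs
      rw [hexp]
      simp only [hR, ih]
      by_cases hpr : p = r
      · subst hpr
        simp only [dif_pos]
        rw [← mul_assoc, ← mul_pow, Matrix.det_succ_column_zero]
        simp only [neg_mul_neg, one_mul, one_pow]
        rfl
      · rw [dif_neg (by omega)]
        simp [hpr]

end Wick

/-! ### The Araki–Wyss representation -/

section ArakiWyss

variable {ι κ : Type} {B : Type*} [CStarAlgebra B] {b b' : ι → B}

theorem smear_cross_anticomm (hb : IsCAR b) (hb' : IsCAR b')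
    (h : ∀ k l, b k * b' l + b' l * b k = 0) (f g : lp (fun _ : ι => ℂ) 2) :
    smear b f * smear b' g + smear b' g * smear b f = 0 :=
  hb.smear_anticomm_of f fun k => by
    rw [add_comm]
    exact hb'.smear_anticomm_of g fun l => by rw [add_comm, h]

theorem smear_cross_star_anticomm (hb : IsCAR b) (hb' : IsCAR b')
    (h : ∀ k l, star (b k) * b' l + b' l * star (b k) = 0) (f g : lp (fun _ : ι => ℂ) 2) :
    smear b f * star (smear b' g) + star (smear b' g) * smear b f = 0 :=
  hb.smear_anticomm_of f fun k => by
    have h1 := hb'.smear_anticomm_of g (z := star (b k)) fun l => by rw [add_comm, h]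
    simpa using congrArg star h1

/-- The Araki–Wyss annihilators `b(f_j) + b'(g_j)†` built from two mutually anticommuting families:
the vacuum expectation sees only the second term at the right end of a product. -/
def arakiWyss (b b' : ι → B) (f g : κ → lp (fun _ : ι => ℂ) 2) (j : κ) : B :=
  smear b (f j) + star (smear b' (g j))

theorem isCAR_arakiWyss [DecidableEq κ] (hb : IsCAR b) (hb' : IsCAR b')
    (h : ∀ k l, b k * b' l + b' l * b k = 0)
    (hs : ∀ k l, star (b k) * b' l + b' l * star (b k) = 0) {f g : κ → lp (fun _ : ι => ℂ) 2}
    (hfg : ∀ i j, (inner ℂ (f i) (f j) + inner ℂ (g j) (g i) : ℂ) = if i = j then 1 else 0) :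
    IsCAR (arakiWyss b b' f g) := by
  have key (i j : κ) : star (arakiWyss b b' f g i) * arakiWyss b b' f g j +
      arakiWyss b b' f g j * star (arakiWyss b b' f g i) =
        (if i = j then 1 else 0 : ℂ) • 1 := by
    have h1 := hb.star_smear_anticomm (f i) (f j)
    have h2 := hb'.star_smear_anticomm (g j) (g i)
    have h3 := smear_cross_anticomm hb hb' h (f j) (g i)
    have h4 := congrArg star (smear_cross_anticomm hb hb' h (f i) (g j))
    rw [star_add, star_mul, star_mul, star_zero] at h4
    rw [← hfg, add_smul]
    simp only [arakiWyss, star_add, star_star]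
    linear_combination (norm := noncomm_ring) h1 + h2 + h3 + h4
  refine ⟨fun j => by simpa using key j j, fun j k hjk => by simpa [hjk] using key j k,
    fun j k => ?_⟩
  have h1 := hb.smear_anticomm (f j) (f k)
  have h2 := congrArg star (hb'.smear_anticomm (g j) (g k))
  have h3 := smear_cross_star_anticomm hb hb' hs (f j) (g k)
  have h4 := smear_cross_star_anticomm hb hb' hs (f k) (g j)
  rw [star_add, star_mul, star_mul, star_zero] at h2
  simp only [arakiWyss]
  linear_combination (norm := noncomm_ring) h1 + h2 + h3 + h4

theorem star_smear_anticomm_arakiWyss (hb : IsCAR b) (hb' : IsCAR b')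
    (hs : ∀ k l, star (b k) * b' l + b' l * star (b k) = 0) (f g : κ → lp (fun _ : ι => ℂ) 2)
    (j k : κ) :
    star (smear b' (g j)) * arakiWyss b b' f g k + arakiWyss b b' f g k * star (smear b' (g j)) =
      0 := by
  have h1 := smear_cross_star_anticomm hb hb' hs (f k) (g j)
  have h2 := congrArg star (hb'.smear_anticomm (g j) (g k))
  rw [star_add, star_mul, star_mul, star_zero] at h2
  simp only [arakiWyss]
  linear_combination (norm := noncomm_ring) h1 + h2

theorem star_smear_anticomm_star_arakiWyss (hb : IsCAR b) (hb' : IsCAR b')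
    (h : ∀ k l, b k * b' l + b' l * b k = 0) (f g : κ → lp (fun _ : ι => ℂ) 2) (j i : κ) :
    star (smear b' (g j)) * star (arakiWyss b b' f g i) +
      star (arakiWyss b b' f g i) * star (smear b' (g j)) = (inner ℂ (g j) (g i) : ℂ) • 1 := by
  have h1 := congrArg star (smear_cross_anticomm hb hb' h (f i) (g j))
  rw [star_add, star_mul, star_mul, star_zero] at h1
  simp only [arakiWyss, star_add, star_star]
  linear_combination (norm := noncomm_ring) hb'.star_smear_anticomm (g j) (g i) + h1

theorem smear_apply_eq_zero {H : Type} [NormedAddCommGroup H] [InnerProductSpace ℂ H]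
    [CompleteSpace H] {b : ι → H →L[ℂ] H} (hb : IsCAR b) (f : lp (fun _ : ι => ℂ) 2) {Ω : H}
    (hΩ : ∀ k, b k Ω = 0) : smear b f Ω = 0 := by
  have h := (hb.hasSum_smear f).mapL (ContinuousLinearMap.apply ℂ H Ω)
  refine h.unique (hasSum_zero.of_eq fun k => ?_)
  simp [hΩ]

end ArakiWyss

/-! ### Quasi-free states -/

section QuasiFree

/-- The vector functional `x ↦ ⟨Ω, x Ω⟩`. -/
def vectorFunctional {H : Type} [NormedAddCommGroup H] [InnerProductSpace ℂ H] [CompleteSpace H]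
    (Ω : H) : (H →L[ℂ] H) →L[ℂ] ℂ :=
  (innerSL ℂ Ω).comp (ContinuousLinearMap.apply ℂ H Ω)

theorem vectorFunctional_apply {H : Type} [NormedAddCommGroup H] [InnerProductSpace ℂ H]
    [CompleteSpace H] (Ω : H) (x : H →L[ℂ] H) : vectorFunctional Ω x = inner ℂ Ω (x Ω) := rfl

theorem StarAlgHom.continuous_of_cstar {A B : Type*} [CStarAlgebra A] [CStarAlgebra B]
    (φ : A →⋆ₐ[ℂ] B) : Continuous φ :=
  AddMonoidHomClass.continuous_of_bound φ 1 fun x => by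
    simpa using NonUnitalStarAlgHom.norm_apply_le φ x

/-- The basis vector `e_m` of `ℓ²(ℤ)`. -/
def basisVec (m : ℤ) : EllTwo := lp.single 2 m (1 : ℂ)

theorem inner_basisVec_left (m : ℤ) (ψ : EllTwo) : inner ℂ (basisVec m) ψ = ψ m := by
  simp [basisVec, lp.inner_single_left]

theorem entry_eq_apply (Q : EllTwo →L[ℂ] EllTwo) (m n : ℤ) : entry Q m n = Q (basisVec m) n :=
  inner_basisVec_left _ _

theorem basisVec_apply (m n : ℤ) : basisVec m n = if n = m then 1 else 0 := by
  rw [basisVec, lp.single_apply, Pi.single_apply]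

theorem entry_star_mul_self (X : EllTwo →L[ℂ] EllTwo) (m n : ℤ) :
    entry (star X * X) m n = inner ℂ (X (basisVec n)) (X (basisVec m)) := by
  rw [entry, ContinuousLinearMap.star_eq_adjoint, mul_apply_eq_comp,
    ContinuousLinearMap.adjoint_inner_right]
  rfl

theorem exists_eq_star_mul_self {A : Type*} [CStarAlgebra A] [PartialOrder A] [StarOrderedRing A]
    {x : A} (hx : 0 ≤ x) : ∃ y, x = star y * y :=
  CStarAlgebra.nonneg_iff_eq_star_mul_self.mp hx

section Vacuum

variable {ι κ : Type} {H : Type} [NormedAddCommGroup H] [InnerProductSpace ℂ H] [CompleteSpace H]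

theorem vectorFunctional_star (Ω : H) (x : H →L[ℂ] H) :
    vectorFunctional Ω (star x) = star (vectorFunctional Ω x) := by
  rw [vectorFunctional_apply, vectorFunctional_apply, ContinuousLinearMap.star_eq_adjoint,
    ContinuousLinearMap.adjoint_inner_right, Complex.star_def, inner_conj_symm]

theorem vectorFunctional_star_mul (Ω : H) (x y : H →L[ℂ] H) :
    vectorFunctional Ω (star x * y) = inner ℂ (x Ω) (y Ω) := by
  rw [vectorFunctional_apply, ContinuousLinearMap.star_eq_adjoint, mul_apply_eq_comp,
    ContinuousLinearMap.adjoint_inner_right]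

open scoped ComplexOrder in
/-- A unit vector in a representation of a `*`-algebra on a Hilbert space gives a state. -/
def vectorState {A : Type*} [Ring A] [StarRing A] [Algebra ℂ A] (π : A →⋆ₐ[ℂ] (H →L[ℂ] H)) (Ω : H)
    (hΩ : (inner ℂ Ω Ω : ℂ) = 1) : AlgState A where
  toLinearMap := (vectorFunctional Ω).toLinearMap ∘ₗ π.toAlgHom.toLinearMap
  map_one' := by
    change vectorFunctional Ω (π 1) = 1
    rw [map_one]
    exact hΩ
  nonneg' x := by
    change 0 ≤ vectorFunctional Ω (π (star x * x))
    rw [map_mul, map_star, vectorFunctional_star_mul, inner_self_eq_norm_sq_to_K]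
    exact pow_nonneg (Complex.zero_le_real.mpr (norm_nonneg (π x Ω))) 2

theorem vectorState_apply {A : Type*} [Ring A] [StarRing A] [Algebra ℂ A]
    (π : A →⋆ₐ[ℂ] (H →L[ℂ] H)) (Ω : H) (hΩ : (inner ℂ Ω Ω : ℂ) = 1) (x : A) :
    vectorState π Ω hΩ x = vectorFunctional Ω (π x) := rfl

/-- The vacuum expectation of a normal-ordered product of Araki–Wyss operators is a determinant of
the inner products `⟨g_j, g_i⟩`. -/
theorem vectorFunctional_arakiWyss {b b' : ι → H →L[ℂ] H} (hb : IsCAR b) (hb' : IsCAR b')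
    (h : ∀ k l, b k * b' l + b' l * b k = 0)
    (hs : ∀ k l, star (b k) * b' l + b' l * star (b k) = 0) (f g : κ → lp (fun _ : ι => ℂ) 2)
    {Ω : H} (hΩ : (inner ℂ Ω Ω : ℂ) = 1) (hbΩ : ∀ k, b k Ω = 0) (hbΩ' : ∀ k, b' k Ω = 0)
    (p q : ℕ) (i : Fin p → κ) (j : Fin q → κ) :
    vectorFunctional Ω ((List.ofFn fun k => star (arakiWyss b b' f g (i k))).prod *
        (List.ofFn fun l => arakiWyss b b' f g (j l)).reverse.prod) =
      if h : p = q then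
        Matrix.det (Matrix.of fun k l : Fin p =>
          (inner ℂ (g (j (Fin.cast h l))) (g (i k)) : ℂ))
      else 0 := by
  refine wick (a := arakiWyss b b' f g) (D := fun j => star (smear b' (g j)))
    (q := fun i j => inner ℂ (g j) (g i)) (vectorFunctional Ω).toLinearMap hΩ
    (vectorFunctional_star Ω) (fun x j => ?_) (fun x j => ?_)
    (star_smear_anticomm_arakiWyss hb hb' hs f g)
    (star_smear_anticomm_star_arakiWyss hb hb' h f g) q p i j
  · change vectorFunctional Ω (x * arakiWyss b b' f g j) =
      vectorFunctional Ω (x * star (smear b' (g j)))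
    rw [vectorFunctional_apply, vectorFunctional_apply, mul_apply_eq_comp, mul_apply_eq_comp,
      arakiWyss, add_apply, smear_apply_eq_zero hb (f j) hbΩ, zero_add]
  · change vectorFunctional Ω (star (smear b' (g j)) * x) = 0
    rw [vectorFunctional_star_mul, smear_apply_eq_zero hb' (g j) hbΩ', inner_zero_left]

end Vacuum

/-- Every symbol `0 ≤ Q ≤ 1` has a norm-continuous gauge-invariant quasi-free state: with
`Q = X†X` and `1 - Q = Y†Y` it is the Fock vacuum state of the Araki–Wyss annihilators
`b(conj (Y e_j)) + b'(X e_j)†`. -/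
theorem exists_isQuasiFreeState {Q : EllTwo →L[ℂ] EllTwo} (hQ0 : 0 ≤ Q) (hQ1 : Q ≤ 1) :
    ∃ ω : AlgState (CAR ℤ), IsQuasiFreeState ω Q ∧ Continuous fun x => ω x := by
  obtain ⟨X, hX⟩ := exists_eq_star_mul_self hQ0
  obtain ⟨Y, hY⟩ := exists_eq_star_mul_self (sub_nonneg.mpr hQ1)
  let H := lp (fun _ : Finset (ℤ ⊕ₗ ℤ) => ℂ) 2
  let Ω : H := fockVacuum (ℤ ⊕ₗ ℤ)
  have hCAR : IsCAR (fockAnn : ℤ ⊕ₗ ℤ → H →L[ℂ] H) := isCAR_fockAnn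
  let b : ℤ → H →L[ℂ] H := fun k => fockAnn (toLex (Sum.inl k) : ℤ ⊕ₗ ℤ)
  let b' : ℤ → H →L[ℂ] H := fun k => fockAnn (toLex (Sum.inr k) : ℤ ⊕ₗ ℤ)
  have hb : IsCAR b := hCAR.comp ⟨_, toLex.injective.comp Sum.inl_injective⟩
  have hb' : IsCAR b' := hCAR.comp ⟨_, toLex.injective.comp Sum.inr_injective⟩
  have h (k l : ℤ) : b k * b' l + b' l * b k = 0 := hCAR.anticomm _ _
  have hs (k l : ℤ) : star (b k) * b' l + b' l * star (b k) = 0 :=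
    hCAR.star_anticomm _ _ (toLex.injective.ne Sum.inl_ne_inr)
  let f : ℤ → EllTwo := fun j => star (Y (basisVec j))
  let g : ℤ → EllTwo := fun j => X (basisVec j)
  have hg (i j : ℤ) : (inner ℂ (g j) (g i) : ℂ) = entry Q i j := by rw [hX, entry_star_mul_self]
  have hf (i j : ℤ) : (inner ℂ (f i) (f j) : ℂ) = entry (1 - Q) i j := by
    rw [hY, entry_star_mul_self]
    refine (lp.hasSum_inner _ _).unique
      ((lp.hasSum_inner (Y (basisVec j)) (Y (basisVec i))).of_eq fun k => ?_)
    simp [f, lp.star_apply, RCLike.inner_apply, mul_comm]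
  have hfg (i j : ℤ) :
      (inner ℂ (f i) (f j) + inner ℂ (g j) (g i) : ℂ) = if i = j then 1 else 0 := by
    rw [hf, hg, entry_eq_apply, entry_eq_apply]
    simp [basisVec_apply, eq_comm]
  have haw := isCAR_arakiWyss hb hb' h hs hfg
  have : Nontrivial (H →L[ℂ] H) := by
    have : Nontrivial H := ⟨Ω, 0, fun h0 => by
      simpa [Ω, fockVacuum, lp.single_apply] using congrArg (fun ψ : H => ψ ∅) h0⟩
    infer_instance
  obtain ⟨π, hπ, -⟩ := CAR.existsUnique_lift haw
  have hbΩ (k : ℤ) : b k Ω = 0 := fockAnn_fockVacuum _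
  have hbΩ' (k : ℤ) : b' k Ω = 0 := fockAnn_fockVacuum _
  have hΩ : (inner ℂ Ω Ω : ℂ) = 1 := inner_fockVacuum_self
  refine ⟨vectorState π Ω hΩ, fun p q i j => ?_, ?_⟩
  · rw [vectorState_apply, map_mul, map_list_prod, map_list_prod, List.map_reverse,
      List.map_ofFn, List.map_ofFn]
    simp only [Function.comp_def, map_star, hπ]
    rw [vectorFunctional_arakiWyss hb hb' h hs f g hΩ hbΩ hbΩ']
    simp only [hg]
  · exact (vectorFunctional Ω).continuous.comp (StarAlgHom.continuous_of_cstar π)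

end QuasiFree

/-! ### Normal-ordered monomials and stationarity -/

section NormalOrder

variable {ι : Type}

namespace CAR

/-- The linear span of the normal-ordered monomials `a†_{i_1} ⋯ a†_{i_p} a_{j_1} ⋯ a_{j_q}`. -/
def normalOrderedSpan (ι : Type) : Submodule ℂ (CAR ι) :=
  Submodule.span ℂ (Set.range fun L : List ι × List ι =>
    (L.1.map fun i => star (a i)).prod * (L.2.map a).prod)

theorem monomial_mem (L M : List ι) :
    (L.map fun i => star (a i)).prod * (M.map a).prod ∈ normalOrderedSpan ι :=
  Submodule.subset_span ⟨(L, M), rfl⟩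

theorem star_a_mul_mem (k : ι) {x : CAR ι} (hx : x ∈ normalOrderedSpan ι) :
    star (a k) * x ∈ normalOrderedSpan ι := by
  induction hx using Submodule.span_induction with
  | mem x hx =>
    obtain ⟨⟨L, M⟩, rfl⟩ := hx
    simpa [mul_assoc] using monomial_mem (k :: L) M
  | zero => simp
  | add x y _ _ hx hy => rw [mul_add]; exact add_mem hx hy
  | smul r x _ hx => rw [mul_smul_comm]; exact Submodule.smul_mem _ r hx

/-- Anticommuting `a_k` to the right past the creators leaves only normal-ordered terms. -/
theorem a_mul_mem (k : ι) {x : CAR ι} (hx : x ∈ normalOrderedSpan ι) :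
    a k * x ∈ normalOrderedSpan ι := by
  classical
  induction hx using Submodule.span_induction with
  | mem x hx =>
    obtain ⟨⟨L, M⟩, rfl⟩ := hx
    induction L with
    | nil => simpa using monomial_mem [] (k :: M)
    | cons i L ih =>
      have h : a k * star (a i) = (if i = k then 1 else 0 : ℂ) • 1 - star (a i) * a k := by
        have := isCAR_a.star_anticomm_eq i k
        rw [eq_sub_iff_add_eq, add_comm, this]
        split_ifs <;> simp
      simp only [List.map_cons, List.prod_cons, mul_assoc] at ih ⊢
      rw [← mul_assoc (a k), h, sub_mul, smul_mul_assoc, one_mul, mul_assoc]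
      exact sub_mem (Submodule.smul_mem _ _ (monomial_mem L M)) (star_a_mul_mem i ih)
  | zero => simp
  | add x y _ _ hx hy => rw [mul_add]; exact add_mem hx hy
  | smul r x _ hx => rw [mul_smul_comm]; exact Submodule.smul_mem _ r hx

theorem mem_normalOrderedSpan {x : CAR ι}
    (hx : x ∈ StarAlgebra.adjoin ℂ (Set.range (a (ι := ι)))) : x ∈ normalOrderedSpan ι := by
  rw [← StarSubalgebra.mem_toSubalgebra, StarAlgebra.adjoin_toSubalgebra] at hx
  -- Left multiplication by the generators preserves the span, which contains `1`.
  have key : ∀ y ∈ normalOrderedSpan ι, x * y ∈ normalOrderedSpan ι := by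
    induction hx using Algebra.adjoin_induction with
    | mem x hx =>
      intro y hy
      rcases hx with ⟨k, rfl⟩ | ⟨k, hk⟩
      · exact a_mul_mem k hy
      · rw [← star_star x, ← hk]
        exact star_a_mul_mem k hy
    | algebraMap r =>
      intro y hy
      rw [← Algebra.smul_def]
      exact Submodule.smul_mem _ r hy
    | add x y _ _ hx hy => intro z hz; rw [add_mul]; exact add_mem (hx z hz) (hy z hz)
    | mul x y _ _ hx hy => intro z hz; rw [mul_assoc]; exact hx _ (hy z hz)
  simpa using key 1 (by simpa using monomial_mem ([] : List ι) [])

theorem dense_adjoin :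
    Dense (StarAlgebra.adjoin ℂ (Set.range (a (ι := ι))) : Set (CAR ι)) := by
  rw [Subtype.dense_iff]
  have h : ((↑) : CAR ι → CARProd ι) '' (StarAlgebra.adjoin ℂ (Set.range (a (ι := ι)))) =
      (StarAlgebra.adjoin ℂ (Set.range (CARProd.ann (ι := ι))) : Set (CARProd ι)) := by
    have := StarAlgHom.map_adjoin (CARSub ι).subtype (Set.range (a (ι := ι)))
    rw [← Set.range_comp] at this
    exact congrArg (fun S : StarSubalgebra ℂ (CARProd ι) => (S : Set (CARProd ι))) this
  exact fun x hx => (congrArg closure h).ge hx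

/-- Continuous linear functionals on the CAR algebra are determined by their values on
normal-ordered monomials. -/
theorem functional_ext {φ ψ : CAR ι →ₗ[ℂ] ℂ} (hφ : Continuous φ) (hψ : Continuous ψ)
    (h : ∀ L M : List ι, φ ((L.map fun i => star (a i)).prod * (M.map a).prod) =
      ψ ((L.map fun i => star (a i)).prod * (M.map a).prod)) : φ = ψ := by
  refine DFunLike.coe_injective (hφ.ext_on dense_adjoin hψ fun x hx => ?_)
  refine LinearMap.eqOn_span ?_ (mem_normalOrderedSpan hx)
  rintro _ ⟨⟨L, M⟩, rfl⟩
  exact h L M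

end CAR

/-- A continuous quasi-free state with a Toeplitz symbol is stationary. -/
theorem IsQuasiFreeState.isStationaryState {ω : AlgState (CAR ℤ)} {Q : EllTwo →L[ℂ] EllTwo}
    (hω : IsQuasiFreeState ω Q) (hc : Continuous fun x => ω x) (hQ : IsToeplitz Q) :
    IsStationaryState ω := by
  have hQ' (m n : ℤ) : entry Q (m + 1) (n + 1) = entry Q m n := hQ m n 1
  let τ := CAR.reindex (addRightEmbedding (1 : ℤ))
  have hτ (j : ℤ) : τ (CAR.a j) = CAR.a (j + 1) := rfl
  suffices h : ω.toLinearMap ∘ₗ τ.toAlgHom.toLinearMap = ω.toLinearMap from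
    fun x => LinearMap.congr_fun h x
  refine CAR.functional_ext (hc.comp (StarAlgHom.continuous_of_cstar τ)) hc fun L M => ?_
  have hL : (L.map fun i => star (CAR.a i)) = List.ofFn fun k => star (CAR.a (L.get k)) :=
    (congrArg (List.map fun i => star (CAR.a i)) (List.ofFn_get L)).symm.trans
      List.map_ofFn
  have hM : M.map CAR.a = (List.ofFn fun l => CAR.a (M.reverse.get l)).reverse := by
    rw [← List.reverse_reverse (M.map CAR.a), ← List.map_reverse]
    exact congrArg List.reverse
      ((congrArg (List.map CAR.a) (List.ofFn_get M.reverse)).symm.trans List.map_ofFn)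
  rw [hL, hM]
  have h1 := hω _ _ L.get M.reverse.get
  have h2 := hω _ _ (fun k => L.get k + 1) (fun l => M.reverse.get l + 1)
  simp only [hQ'] at h2
  rw [h1, ← h2]
  change ω (τ _) = _
  rw [map_mul, map_list_prod, map_list_prod, List.map_reverse, List.map_ofFn, List.map_ofFn]
  simp only [Function.comp_def, map_star, hτ]

end NormalOrder

/-! ### The symbol -/

section Symbol

/-- The bilateral shift `e_m ↦ e_{m + k}`. -/
def shiftOp (k : ℤ) : EllTwo →L[ℂ] EllTwo :=
  weightedComp (fun _ => 1) (Equiv.subRight k) (by simp)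

theorem star_shiftOp (k : ℤ) : star (shiftOp k) = shiftOp (-k) := by
  rw [shiftOp, star_weightedComp]
  ext ψ n
  simp [shiftOp]

theorem entry_shiftOp (k m n : ℤ) : entry (shiftOp k) m n = if k = n - m then 1 else 0 := by
  rw [entry_eq_apply, shiftOp, weightedComp_apply, basisVec_apply, one_mul]
  exact if_congr ⟨fun h => by simp at h; omega, fun h => by simp; omega⟩ rfl rfl

/-- The Fourier coefficients `t_k = -i sign(k) · 3 / (2 π² k²)` of the off-diagonal part of the
symbol; `t_0 = 0`. -/
def symbolCoeff (k : ℤ) : ℂ :=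
  -Complex.I * ((3 / (2 * Real.pi ^ 2) * (k.sign / (k : ℝ) ^ 2) : ℝ) : ℂ)

/-- The coefficients are Hermitian, since `sign` is odd and `i` is imaginary. -/
theorem star_symbolCoeff (k : ℤ) : star (symbolCoeff k) = symbolCoeff (-k) := by
  simp only [symbolCoeff, Complex.star_def, map_mul, map_neg, Complex.conj_I, Complex.conj_ofReal,
    Int.sign_neg]
  push_cast
  ring

theorem norm_symbolCoeff (k : ℤ) :
    ‖symbolCoeff k‖ = 3 / (2 * Real.pi ^ 2) * (1 / (k : ℝ) ^ 2) := by
  rw [symbolCoeff, norm_mul, norm_neg, Complex.norm_I, one_mul, Complex.norm_real, norm_mul,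
    Real.norm_of_nonneg (by positivity), norm_div, Real.norm_of_nonneg (sq_nonneg (k : ℝ))]
  rcases eq_or_ne k 0 with rfl | hk
  · simp
  · have : ‖((k.sign : ℤ) : ℝ)‖ = 1 := by
      rcases lt_or_gt_of_ne hk with h | h
      · simp [Int.sign_eq_neg_one_of_neg h]
      · simp [Int.sign_eq_one_of_pos h]
    rw [this]

/-- This is `2 · 3 / (2 π²) · ζ(2) = 1 / 2`. -/
theorem hasSum_norm_symbolCoeff : HasSum (fun k => ‖symbolCoeff k‖) (1 / 2) := by
  have h := hasSum_zeta_two.mul_left (3 / (2 * Real.pi ^ 2))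
  have h1 : HasSum (fun n : ℕ => ‖symbolCoeff n‖) (3 / (2 * Real.pi ^ 2) * (Real.pi ^ 2 / 6)) :=
    h.of_eq fun n => by rw [norm_symbolCoeff]; simp
  have h2 : HasSum (fun n : ℕ => ‖symbolCoeff (-n)‖) (3 / (2 * Real.pi ^ 2) * (Real.pi ^ 2 / 6)) :=
    h.of_eq fun n => by rw [norm_symbolCoeff]; simp
  have h3 := HasSum.of_nat_of_neg (f := fun k : ℤ => ‖symbolCoeff k‖) h1 h2
  have h4 : 3 / (2 * Real.pi ^ 2) * (Real.pi ^ 2 / 6) = 1 / 4 := by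
    have := Real.pi_ne_zero
    field_simp
    norm_num
  have h5 : ‖symbolCoeff 0‖ = 0 := by simp [symbolCoeff]
  rw [h4, h5] at h3
  norm_num at h3 ⊢
  exact h3

/-- The off-diagonal part `∑ₖ t_k S_k` of the symbol. -/
def offDiag : EllTwo →L[ℂ] EllTwo := ∑' k, symbolCoeff k • shiftOp k

theorem norm_symbolCoeff_smul_le (k : ℤ) : ‖symbolCoeff k • shiftOp k‖ ≤ ‖symbolCoeff k‖ := by
  rw [norm_smul]
  exact mul_le_of_le_one_right (norm_nonneg _) (norm_weightedComp_le _ _ _)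

theorem hasSum_offDiag : HasSum (fun k => symbolCoeff k • shiftOp k) offDiag :=
  (Summable.of_norm_bounded hasSum_norm_symbolCoeff.summable norm_symbolCoeff_smul_le).hasSum

theorem norm_offDiag_le : ‖offDiag‖ ≤ 1 / 2 :=
  hasSum_offDiag.norm_le_of_bounded hasSum_norm_symbolCoeff norm_symbolCoeff_smul_le

theorem isSelfAdjoint_offDiag : IsSelfAdjoint offDiag := by
  have h := hasSum_offDiag.star
  rw [← (Equiv.neg ℤ).hasSum_iff] at h
  refine h.unique (hasSum_offDiag.of_eq fun k => ?_)
  simp [star_smul, star_symbolCoeff, star_shiftOp]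

theorem entry_offDiag (m n : ℤ) : entry offDiag m n = symbolCoeff (n - m) := by
  have h := hasSum_offDiag.mapL
    ((innerSL ℂ (basisVec n)).comp (ContinuousLinearMap.apply ℂ EllTwo (basisVec m)))
  refine h.unique ((hasSum_ite_eq (n - m) (symbolCoeff (n - m))).of_eq fun k => ?_)
  rw [map_smul]
  change symbolCoeff k * entry (shiftOp k) m n = _
  rw [entry_shiftOp]
  split_ifs with hk
  · rw [hk, mul_one]
  · rw [mul_zero]

/-- A self-adjoint operator of norm at most `r` is at least `-r`. -/
theorem smul_one_add_nonneg {T : EllTwo →L[ℂ] EllTwo} (hT : IsSelfAdjoint T) {r : ℝ}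
    (hr : ‖T‖ ≤ r) : 0 ≤ (r : ℂ) • 1 + T := by
  rw [ContinuousLinearMap.nonneg_iff_isPositive, ContinuousLinearMap.isPositive_def']
  refine ⟨.add (.smul (Complex.conj_ofReal r) (.one _)) hT, fun x => ?_⟩
  have h1 : -(r * ‖x‖ ^ 2) ≤ (inner ℂ (T x) x : ℂ).re := by
    have h2 := (Complex.abs_re_le_norm _).trans (norm_inner_le_norm (𝕜 := ℂ) (T x) x)
    have h3 : ‖T x‖ * ‖x‖ ≤ r * ‖x‖ ^ 2 := by
      rw [sq, ← mul_assoc]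
      exact mul_le_mul_of_nonneg_right (T.le_of_opNorm_le hr x) (norm_nonneg x)
    exact neg_le_of_abs_le (h2.trans h3)
  have h4 : (inner ℂ x x : ℂ) = (‖x‖ : ℂ) ^ 2 := inner_self_eq_norm_sq_to_K x
  have h5 : ((r : ℂ) * (‖x‖ : ℂ) ^ 2).re = r * ‖x‖ ^ 2 := by norm_cast
  rw [ContinuousLinearMap.reApplyInnerSelf_apply]
  simp only [add_apply, smul_apply,
    one_apply_eq_self, inner_add_left, inner_smul_left, Complex.conj_ofReal, h4, map_add]
  change 0 ≤ ((r : ℂ) * (‖x‖ : ℂ) ^ 2).re + (inner ℂ (T x) x : ℂ).re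
  rw [h5]
  linarith

/-- The symbol `Q`, with diagonal `1/2`, which is also the sum of the absolute values of the
off-diagonal entries in each row. -/
def symbol : EllTwo →L[ℂ] EllTwo := ((1 / 2 : ℝ) : ℂ) • 1 + offDiag

theorem symbol_nonneg : 0 ≤ symbol := smul_one_add_nonneg isSelfAdjoint_offDiag norm_offDiag_le

theorem symbol_le_one : symbol ≤ 1 := by
  have h := smul_one_add_nonneg isSelfAdjoint_offDiag.neg (r := 1 / 2)
    (by rw [norm_neg]; exact norm_offDiag_le)
  rw [← sub_nonneg]
  convert h using 1
  rw [symbol, ← sub_sub, ← sub_eq_add_neg]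
  congr 1
  rw [sub_eq_iff_eq_add, ← add_smul]
  norm_num

theorem entry_symbol (m n : ℤ) :
    entry symbol m n = (if m = n then 1 / 2 else 0) + symbolCoeff (n - m) := by
  rw [← entry_offDiag, entry_eq_apply, entry_eq_apply]
  change ((1 / 2 : ℝ) : ℂ) * basisVec m n + offDiag (basisVec m) n = _
  rw [basisVec_apply]
  simp [eq_comm]

theorem entry_symbol_of_ne {m n : ℤ} (h : n ≠ m) : entry symbol m n = symbolCoeff (n - m) := by
  rw [entry_symbol, if_neg h.symm, zero_add]

theorem isToeplitz_symbol : IsToeplitz symbol := fun m n k => by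
  simp [entry_symbol]

theorem isDiagDominant_symbol : IsDiagDominant symbol := by
  intro m
  have h : HasSum (fun n : ℤ => ‖symbolCoeff (n - m)‖) (1 / 2) :=
    (Equiv.subRight m).hasSum_iff.mpr hasSum_norm_symbolCoeff
  have he : (fun n : {n : ℤ // n ≠ m} => ‖entry symbol m n‖) =
      fun n : {n : ℤ // n ≠ m} => ‖symbolCoeff (n - m)‖ :=
    funext fun n => by rw [entry_symbol_of_ne n.2]
  have hd : ‖entry symbol m m‖ = 1 / 2 := by
    simp [entry_symbol, symbolCoeff]
  rw [he, hd]
  refine ⟨h.summable.subtype _, ?_⟩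
  rw [← h.tsum_eq]
  exact Summable.tsum_subtype_le _ _ (fun n => norm_nonneg _) h.summable

end Symbol

theorem proposition3 :
    ∃ C : ℝ, 0 < C ∧
      ∃ Q : EllTwo →L[ℂ] EllTwo,
        IsToeplitz Q ∧ 0 ≤ Q ∧ Q ≤ 1 ∧ IsDiagDominant Q ∧
        ∃ ω : AlgState (CAR ℤ), IsStationaryState ω ∧ IsQuasiFreeState ω Q ∧
          ∀ m n : ℤ, n < m →
            ω (star (CAR.a m) * CAR.a n) =
              Complex.I * (3 * (C : ℂ) / ((Real.pi : ℂ) ^ 2 * ((m : ℂ) - (n : ℂ)) ^ 2)) := by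
  obtain ⟨ω, hω, hc⟩ := exists_isQuasiFreeState symbol_nonneg symbol_le_one
  refine ⟨1 / 2, by norm_num, symbol, isToeplitz_symbol, symbol_nonneg, symbol_le_one,
    isDiagDominant_symbol, ω, hω.isStationaryState hc isToeplitz_symbol, hω, fun m n hmn => ?_⟩
  have h : ω (star (CAR.a m) * CAR.a n) = entry symbol m n := by
    simpa using hω 1 1 (fun _ => m) (fun _ => n)
  have hmn' : (m : ℂ) - n ≠ 0 := sub_ne_zero.mpr (by exact_mod_cast hmn.ne')
  have hnm' : (n : ℂ) - m ≠ 0 := sub_ne_zero.mpr (by exact_mod_cast hmn.ne)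
  have hpi : (Real.pi : ℂ) ≠ 0 := by exact_mod_cast Real.pi_ne_zero
  rw [h, entry_symbol_of_ne hmn.ne, symbolCoeff, Int.sign_eq_neg_one_of_neg (by omega)]
  push_cast
  rw [← neg_sub (m : ℂ) n, neg_sq]
  field_simp

end
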